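/- Let $k$ be a field, let $t\ge 1$ and let $n_1,\dots,n_t\ge 1$ be integers. Let $S=k[y_{i,j} : 1\le i\le t,\ 1\le j\le n_i+1]$ be the standard graded polynomial ring, and let $R=R(n_1,\dots,n_t)=S/I$ be the rational normal scroll of type $(n_1,\dots,n_t)$, where $I$ is the ideal generated by the $2$-minors of the $2\times(n_1+\cdots+n_t)$ matrix whose columns are $\binom{y_{i,j}}{y_{i,j+1}}$ for $1\le i\le t$, $1\le j\le n_i$. The residue classes in $R$ of the variables $y_{i,j}$ are called the natural coordinates of $R$. For a finitely generated graded $R$-module $M$ with minimal graded free resolution $\cdots\to F_1\to F_0\to M\to 0$, let $$\operatorname{reg}_R M=\sup\{\,j-i : F_i \text{ has a basis element of degree } j\,\}$$ be its Castelnuovo–Mumford regularity over $R$ (equivalently, $\sup\{j-i:\operatorname{Tor}^R_i(M,k)_j\neq 0\}$). Then $\operatorname{reg}_R R/(Y)=0$ for every subset $Y$ of the set of natural coordinates of $R$ if and only if $n_1=n_2=\cdots=n_t$. -/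

import Mathlib

noncomputable section

universe u v w

section Regularity

variable {k : Type u} {A : Type v} [CommRing k] [CommRing A] [Algebra k A]

/-- The graded pieces of `A ⧸ I`: the images of the graded pieces of `A`. -/
def quotientGrading (𝒜 : ℤ → Submodule k A) (I : Ideal A) : ℤ → Submodule k (A ⧸ I) :=
  fun j => (𝒜 j).map (Ideal.Quotient.mkₐ k I).toLinearMap

/-- The ideal generated by all homogeneous elements of positive degree. -/
def positiveIdeal (𝒜 : ℤ → Submodule k A) : Ideal A :=
  Ideal.span {a | ∃ j : ℤ, 0 < j ∧ a ∈ 𝒜 j}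

/-- A minimal graded free resolution
`⋯ → F₂ → F₁ → F₀ → M → 0` of a graded module `M` (with graded pieces `ℳ j`) over a graded ring `A`
(with graded pieces `𝒜 j`). The module `F i` is `⨁ b, A(-deg i b)`, a free module of finite rank
whose basis vector number `b` has degree `deg i b`. All maps are homogeneous of degree `0`, and the
matrices of the differentials have their entries in the ideal of elements of positive degree. -/
structure MinimalGradedFreeResolution (𝒜 : ℤ → Submodule k A) {M : Type w} [AddCommGroup M]
    [Module A M] [Module k M] (ℳ : ℤ → Submodule k M) where
  rank : ℕ → ℕ
  deg : (i : ℕ) → Fin (rank i) → ℤ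
  aug : (Fin (rank 0) → A) →ₗ[A] M
  d : (i : ℕ) → (Fin (rank (i + 1)) → A) →ₗ[A] (Fin (rank i) → A)
  aug_surjective : Function.Surjective aug
  exact_aug : Function.Exact (d 0) aug
  exact_d : ∀ i, Function.Exact (d (i + 1)) (d i)
  aug_homogeneous : ∀ b, aug (Pi.single b 1) ∈ ℳ (deg 0 b)
  d_homogeneous : ∀ i b c, d i (Pi.single b 1) c ∈ 𝒜 (deg (i + 1) b - deg i c)
  d_minimal : ∀ i b c, d i (Pi.single b 1) c ∈ positiveIdeal 𝒜

/-- The relative Castelnuovo-Mumford regularity `reg_A M`: the supremum of the numbers `j - i` such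
that the `i`-th module of the minimal graded free resolution of `M` over `A` has a basis element of
degree `j`. It is `⊥` for the zero module and `⊤` if the numbers `j - i` are unbounded.
(The minimal graded free resolution is unique up to isomorphism, so that the supremum over all
of them is the value at any one of them.) -/
def castelnuovoMumfordRegularity (𝒜 : ℤ → Submodule k A) {M : Type w} [AddCommGroup M]
    [Module A M] [Module k M] (ℳ : ℤ → Submodule k M) : EReal :=
  sSup {x | ∃ (F : MinimalGradedFreeResolution 𝒜 ℳ) (i : ℕ) (b : Fin (F.rank i)),
    x = (((F.deg i b - (i : ℤ) : ℤ) : ℝ) : EReal)}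

end Regularity

section Scroll

/-- The standard `ℤ`-grading of a polynomial ring. -/
def polynomialGrading (σ : Type v) (k : Type u) [CommRing k] :
    ℤ → Submodule k (MvPolynomial σ k)
  | Int.ofNat m => MvPolynomial.homogeneousSubmodule σ k m
  | Int.negSucc _ => ⊥

/-- The ideal `I₂(X)` generated by the `2`-minors of a `2 × e` matrix. -/
def idealOfTwoMinors {A : Type v} [CommRing A] {κ : Type w} (X : Matrix (Fin 2) κ A) : Ideal A :=
  Ideal.span {f | ∃ c c' : κ, f = (X.submatrix id ![c, c']).det}

/-- Indices of the variables `y_{i,1}, …, y_{i,n_i+1}`, numbered from `0`. -/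
abbrev ScrollVar {t : ℕ} (n : Fin t → ℕ) : Type := (i : Fin t) × Fin (n i + 1)

/-- The matrix whose `i`-th block has the columns `(y_{i,j}, y_{i,j+1})`, `j = 1, …, n_i`. -/
def scrollMatrix (k : Type u) [CommRing k] {t : ℕ} (n : Fin t → ℕ) :
    Matrix (Fin 2) ((i : Fin t) × Fin (n i)) (MvPolynomial (ScrollVar n) k) :=
  Matrix.of ![fun c => MvPolynomial.X ⟨c.1, c.2.castSucc⟩,
    fun c => MvPolynomial.X ⟨c.1, c.2.succ⟩]

/-- The (homogeneous coordinate ring of the) rational normal scroll of type `n`. -/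
abbrev Scroll (k : Type u) [CommRing k] {t : ℕ} (n : Fin t → ℕ) : Type u :=
  MvPolynomial (ScrollVar n) k ⧸ idealOfTwoMinors (scrollMatrix k n)

def scrollGrading (k : Type u) [CommRing k] {t : ℕ} (n : Fin t → ℕ) :
    ℤ → Submodule k (Scroll k n) :=
  quotientGrading (polynomialGrading (ScrollVar n) k) (idealOfTwoMinors (scrollMatrix k n))

/-- The residue classes of the variables `y_{i,j}` in the scroll. -/
def naturalCoordinates (k : Type u) [CommRing k] {t : ℕ} (n : Fin t → ℕ) : Set (Scroll k n) :=
  Set.range fun v : ScrollVar n => Ideal.Quotient.mk _ (MvPolynomial.X v)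

end Scroll

end

/-! The scroll is a monoid algebra (`scrollEquiv`). The 2-minors shift one unit of position from one
variable to another, so a monomial is determined by its multiset of blocks `α` and its total
position `a`, and the pairs that occur are those with `a ≤ ∑ n i` over `i ∈ α`. Questions about
ideals generated by coordinates thus become divisibility questions in `scrollMonoid n`.

If all `n i` agree, the bound on `a` depends only on the degree of the monomial. Then every monomial
of a colon ideal `(Y) : y` is divisible by a variable of that colon ideal
(`exists_scrollPoint_of_colon`), so `(Y) : y` is again generated by coordinates. This property
propagates along the resolution: a module built by adjoining linear vectors with such colon ideals
has a syzygy module of the same kind (`HasLinearQuotients.exists_cover`). Hence every syzygy module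
is generated by linear vectors. Since the regularity is a supremum over all minimal resolutions, one
linear resolution is constructed and every other one is compared with it step by step.

If `n l < n i`, let `w` and `v` be the first and last variables of block `i`. A power of the last
variable of block `l` lies in `(v) : w`, but no divisor of it of degree at most `1` does. So the
syzygies of `v, w` are not generated by linear ones (`regularity_ne_zero_of_lt`). -/

noncomputable section

universe u v w

/-! ### Linear quotients and linear resolutions over a graded algebra -/

section LinearResolutions

variable {k : Type u} {A : Type v} [CommRing k] [CommRing A] [Algebra k A]

theorem mem_positiveIdeal_of_mem {𝒜 : ℤ → Submodule k A} {j : ℤ} (hj : 0 < j) {a : A}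
    (ha : a ∈ 𝒜 j) : a ∈ positiveIdeal 𝒜 :=
  Ideal.subset_span ⟨j, hj, ha⟩

variable (𝒜 : ℤ → Submodule k A)

theorem proj_mul_of_right_mem [GradedAlgebra 𝒜] {i j l : ℤ} (h : i + j = l) (a : A) {b : A}
    (hb : b ∈ 𝒜 j) :
    GradedAlgebra.proj 𝒜 l (a * b) = GradedAlgebra.proj 𝒜 i a * b := by
  subst h
  exact DirectSum.coe_decompose_mul_add_of_right_mem 𝒜 hb

theorem proj_mem [GradedAlgebra 𝒜] (i : ℤ) (a : A) : GradedAlgebra.proj 𝒜 i a ∈ 𝒜 i :=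
  SetLike.coe_mem _

theorem proj_of_mem [GradedAlgebra 𝒜] {i : ℤ} {a : A} (ha : a ∈ 𝒜 i) : GradedAlgebra.proj 𝒜 i a = a :=
  DirectSum.decompose_of_mem_same 𝒜 ha

/-- The degree `0` part of a multiple `r * x` with `x` of degree `j > 0` is the degree `-j` part of
`r` times `x`, which vanishes. The arbitrary factor `r` makes the statement stable under span
induction. -/
theorem proj_zero_of_mem_positiveIdeal [GradedAlgebra 𝒜] (hneg : ∀ j < 0, 𝒜 j = ⊥) {a : A}
    (ha : a ∈ positiveIdeal 𝒜) : GradedAlgebra.proj 𝒜 0 a = 0 := by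
  suffices h : ∀ r : A, GradedAlgebra.proj 𝒜 0 (r * a) = 0 by simpa using h 1
  induction ha using Submodule.span_induction with
  | mem x hx =>
    obtain ⟨j, hj, hx⟩ := hx
    intro r
    have h : GradedAlgebra.proj 𝒜 (-j) r ∈ (⊥ : Submodule k A) :=
      hneg (-j) (by omega) ▸ proj_mem 𝒜 (-j) r
    rw [proj_mul_of_right_mem 𝒜 (neg_add_cancel j) r hx, (Submodule.mem_bot k).1 h, zero_mul]
  | zero => simp
  | add x y _ _ hx hy => intro r; rw [mul_add, map_add, hx, hy, add_zero]
  | smul s x _ hx => intro r; rw [smul_eq_mul, ← mul_assoc, hx]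

theorem eq_zero_of_mem_positiveIdeal [GradedAlgebra 𝒜] (hneg : ∀ j < 0, 𝒜 j = ⊥) {a : A}
    (ha : a ∈ positiveIdeal 𝒜) (h0 : a ∈ 𝒜 0) : a = 0 := by
  rw [← proj_of_mem 𝒜 h0, proj_zero_of_mem_positiveIdeal 𝒜 hneg ha]

theorem one_notMem_positiveIdeal [GradedAlgebra 𝒜] [Nontrivial A] (hneg : ∀ j < 0, 𝒜 j = ⊥) :
    (1 : A) ∉ positiveIdeal 𝒜 := fun h =>
  one_ne_zero (eq_zero_of_mem_positiveIdeal 𝒜 hneg h SetLike.GradedOne.one_mem)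

theorem span_le_positiveIdeal {Y : Set A} (hY : Y ⊆ 𝒜 1) : Ideal.span Y ≤ positiveIdeal 𝒜 :=
  Ideal.span_le.2 fun _ hy => mem_positiveIdeal_of_mem one_pos (hY hy)

/-- The coefficients of a homogeneous vector with respect to homogeneous vectors can be chosen
homogeneous. -/
theorem exists_homogeneous_coefficients [GradedAlgebra 𝒜] {ι κ : Type*} [Fintype ι]
    (z : ι → κ → A) (δ : ι → ℤ) (ε : κ → ℤ) (hz : ∀ j c, z j c ∈ 𝒜 (δ j - ε c)) {D : ℤ} {x : κ → A}
    (hx : ∀ c, x c ∈ 𝒜 (D - ε c)) (hxz : x ∈ Submodule.span A (Set.range z)) :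
    ∃ a : ι → A, (∀ j, a j ∈ 𝒜 (D - δ j)) ∧ Fintype.linearCombination A z a = x := by
  rw [← Fintype.range_linearCombination] at hxz
  obtain ⟨a, rfl⟩ := hxz
  -- Only the component of each coefficient in the expected degree contributes to `x`.
  refine ⟨fun j => GradedAlgebra.proj 𝒜 (D - δ j) (a j), fun j => proj_mem 𝒜 _ _, ?_⟩
  ext c
  rw [← proj_of_mem 𝒜 (hx c)]
  simp only [Fintype.linearCombination_apply, Finset.sum_apply, Pi.smul_apply, smul_eq_mul,
    map_sum]
  exact Finset.sum_congr rfl fun j _ =>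
    (proj_mul_of_right_mem 𝒜 (by ring) (a j) (hz j c)).symm

/-- Submodules of `A ^ r` that are obtained from `0` by successively adding vectors with linear
entries, in such a way that all the colon ideals that occur are generated by subsets of `V`. -/
inductive HasLinearQuotients (V : Set A) {r : ℕ} : Submodule A (Fin r → A) → Prop
  | bot : HasLinearQuotients V ⊥
  | sup_span {N : Submodule A (Fin r → A)} {z : Fin r → A} {Y : Set A} :
      HasLinearQuotients V N → (∀ c, z c ∈ 𝒜 1) → Y ⊆ V →
      (∀ a : A, a • z ∈ N ↔ a ∈ Ideal.span Y) → HasLinearQuotients V (N ⊔ Submodule.span A {z})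

/-- Colon ideals of ideals generated by elements of `V` are generated by elements of `V`. -/
def HasLinearColonIdeals (V : Set A) : Prop :=
  ∀ Y ⊆ V, ∀ y ∈ V, y ∉ Y → ∃ Y' ⊆ V, ∀ a : A, a * y ∈ Ideal.span Y ↔ a ∈ Ideal.span Y'

variable {𝒜} {V : Set A}

theorem HasLinearQuotients.map {r s : ℕ} {N : Submodule A (Fin r → A)}
    (hN : HasLinearQuotients 𝒜 V N) (f : (Fin r → A) →ₗ[A] (Fin s → A))
    (hf : Function.Injective f) (hf' : ∀ x, (∀ b, x b ∈ 𝒜 1) → ∀ c, f x c ∈ 𝒜 1) :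
    HasLinearQuotients 𝒜 V (N.map f) := by
  induction hN with
  | bot => rw [Submodule.map_bot]; exact .bot
  | sup_span hN hz hY hcolon ih =>
    rw [Submodule.map_sup, Submodule.map_span, Set.image_singleton]
    refine .sup_span ih (hf' _ hz) hY fun a => ?_
    rw [← map_smul, ← hcolon]
    exact ⟨fun ⟨x, hx, h⟩ => hf h ▸ hx, fun h => Submodule.mem_map_of_mem h⟩

/-- A submodule `K` of `A ^ r` has linear quotients if the kernel of a functional on `K` has linear
quotients, and the image is generated by a subset of `V` that lifts to vectors with linear
entries. -/
theorem HasLinearQuotients.extend (hV : V.Finite) (hcolon : HasLinearColonIdeals V) {r : ℕ}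
    {N K : Submodule A (Fin r → A)} (hN : HasLinearQuotients 𝒜 V N) (π : (Fin r → A) →ₗ[A] A)
    {Y : Set A} (hY : Y ⊆ V) (w : A → Fin r → A) (hwK : ∀ y ∈ Y, w y ∈ K)
    (hw : ∀ y ∈ Y, ∀ c, w y c ∈ 𝒜 1) (hπw : ∀ y ∈ Y, π (w y) = y)
    (hNK : ∀ x, x ∈ N ↔ x ∈ K ∧ π x = 0) (hπK : ∀ x ∈ K, π x ∈ Ideal.span Y) :
    HasLinearQuotients 𝒜 V K := by
  have himage : ∀ Z ⊆ Y, (Submodule.span A (w '' Z)).map π = Ideal.span Z := fun Z hZ => by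
    rw [Submodule.map_span, Set.image_image, Set.image_congr fun y hy => hπw y (hZ hy),
      Set.image_id']
  have hspanK : ∀ Z ⊆ Y, Submodule.span A (w '' Z) ≤ K := fun Z hZ =>
    Submodule.span_le.2 (by rintro _ ⟨y, hy, rfl⟩; exact hwK y (hZ hy))
  have hmem : ∀ Z ⊆ Y, ∀ x ∈ K, x ∈ N ⊔ Submodule.span A (w '' Z) ↔ π x ∈ Ideal.span Z := by
    intro Z hZ x hx
    rw [← himage Z hZ]
    constructor
    · intro h
      obtain ⟨p, hp, q, hq, rfl⟩ := Submodule.mem_sup.1 h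
      rw [map_add, ((hNK p).1 hp).2, zero_add]
      exact Submodule.mem_map_of_mem hq
    · rintro ⟨q, hq, hqx⟩
      refine Submodule.mem_sup.2 ⟨x - q, (hNK _).2 ⟨K.sub_mem hx (hspanK Z hZ hq), ?_⟩, q, hq, ?_⟩
      · rw [map_sub, hqx, sub_self]
      · abel
  have hZ : ∀ Z : Set A, Z.Finite → Z ⊆ Y →
      HasLinearQuotients 𝒜 V (N ⊔ Submodule.span A (w '' Z)) := by
    intro Z hfin
    induction Z, hfin using Set.Finite.induction_on with
    | empty => intro _; simpa using hN
    | @insert y Z hyZ _ ih =>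
      intro hZY
      obtain ⟨hy, hZ⟩ := Set.insert_subset_iff.1 hZY
      obtain ⟨Y', hY', hcol⟩ := hcolon Z (hZ.trans hY) y (hY hy) hyZ
      have : N ⊔ Submodule.span A (w '' insert y Z) =
          (N ⊔ Submodule.span A (w '' Z)) ⊔ Submodule.span A {w y} := by
        rw [Set.image_insert_eq, Submodule.span_insert, sup_assoc,
          sup_comm (Submodule.span A {w y})]
      rw [this]
      -- Inside `K`, membership in `N ⊔ span (w '' Z)` can be tested after applying `π`, so the
      -- colon ideal of `w y` is `(Z) : y`.
      refine .sup_span (ih hZ) (hw y hy) hY' fun a => ?_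
      rw [hmem Z hZ _ (K.smul_mem a (hwK y hy)), map_smul, hπw y hy, smul_eq_mul, hcol]
  have hK : N ⊔ Submodule.span A (w '' Y) = K := by
    refine le_antisymm (sup_le (fun x hx => ((hNK x).1 hx).1) (hspanK Y subset_rfl)) ?_
    exact fun x hx => (hmem Y subset_rfl x hx).2 (hπK x hx)
  exact hK ▸ hZ Y (hV.subset hY) subset_rfl

theorem HasLinearQuotients.comap_proj (hV : V.Finite) (hV1 : V ⊆ 𝒜 1)
    (hcolon : HasLinearColonIdeals V) {Y : Set A} (hY : Y ⊆ V) :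
    HasLinearQuotients 𝒜 V
      (Submodule.comap (LinearMap.proj (R := A) (φ := fun _ : Fin 1 => A) 0) (Ideal.span Y)) := by
  refine .extend hV hcolon .bot (LinearMap.proj 0) hY (fun y _ => y) (fun y hy => ?_)
    (fun y hy _ => hV1 (hY hy)) (fun _ _ => rfl) (fun x => ?_) (fun x hx => hx)
  · exact Ideal.subset_span hy
  · rw [Submodule.mem_bot]
    constructor
    · rintro rfl; simp
    · rintro ⟨_, hx⟩
      ext c
      rw [Subsingleton.elim c 0]
      exact hx

/-- The kernel of the map onto a submodule with linear quotients has linear quotients again. -/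
theorem HasLinearQuotients.exists_cover [GradedAlgebra 𝒜] (hV : V.Finite) (hV1 : V ⊆ 𝒜 1)
    (hcolon : HasLinearColonIdeals V) {r : ℕ} {N : Submodule A (Fin r → A)}
    (hN : HasLinearQuotients 𝒜 V N) :
    ∃ (m : ℕ) (z : Fin m → Fin r → A), (∀ j c, z j c ∈ 𝒜 1) ∧
      Submodule.span A (Set.range z) = N ∧
      HasLinearQuotients 𝒜 V (LinearMap.ker (Fintype.linearCombination A z)) := by
  induction hN with
  | bot =>
    refine ⟨0, Fin.elim0, fun j => j.elim0, by simp, ?_⟩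
    have : LinearMap.ker (Fintype.linearCombination A (Fin.elim0 : Fin 0 → Fin r → A)) = ⊥ :=
      Subsingleton.elim _ _
    exact this ▸ .bot
  | @sup_span N x Y hN hx hY hcol ih =>
    obtain ⟨m, z, hz, hspan, hker⟩ := ih
    have hlift : ∀ y ∈ Y, ∃ a : Fin m → A, (∀ j, a j ∈ 𝒜 1) ∧
        Fintype.linearCombination A z a = y • x := by
      intro y hy
      -- The vector `y • x` has entries of degree `2` and the `z j` have entries of degree `1`, so
      -- the coefficients are linear.
      refine exists_homogeneous_coefficients 𝒜 z (fun _ => 1) (fun _ => 0)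
        (fun j c => by simpa using hz j c) (D := 2) (fun c => ?_) ?_
      · exact SetLike.GradedMul.mul_mem (A := 𝒜) (i := 1) (j := 1) (hV1 (hY hy)) (hx c)
      · rw [hspan, hcol]
        exact Ideal.subset_span hy
    choose! a ha hax using hlift
    have hcons : ∀ v : Fin (m + 1) → A,
        Fintype.linearCombination A (Fin.cons x z : Fin (m + 1) → Fin r → A) v =
          v 0 • x + Fintype.linearCombination A z (Fin.tail v) := by
      intro v
      simp [Fintype.linearCombination_apply, Fin.sum_univ_succ, Fin.tail]
    refine ⟨m + 1, Fin.cons x z, ?_, ?_, ?_⟩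
    · intro j
      refine Fin.cases ?_ (fun j => ?_) j
      · simpa using hx
      · simpa using hz j
    · rw [Fin.range_cons, Submodule.span_insert, hspan, sup_comm]
    · let f : (Fin m → A) →ₗ[A] (Fin (m + 1) → A) := LinearMap.vecCons 0 LinearMap.id
      have hf : ∀ v, f v = Fin.cons 0 v := fun v => rfl
      have hf_inj : Function.Injective f := fun v v' h => by
        rw [hf, hf] at h
        exact Fin.cons_right_injective (α := fun _ => A) 0 h
      -- The first coordinate maps the syzygies of `x, z` onto the colon ideal `(Y)` of `x`, and its
      -- kernel is the syzygy module of `z`. The relation `y • x = ∑ a y j • z j` gives the lift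
      -- `(y, -(a y))` of `y`.
      refine .extend hV hcolon (hker.map f hf_inj ?_) (LinearMap.proj 0) hY
        (fun y => Fin.cons y (-(a y))) ?_ ?_ ?_ ?_ ?_
      · intro v hv c
        rw [hf]
        refine Fin.cases ?_ (fun j => ?_) c
        · simp
        · simpa using hv j
      · intro y hy
        rw [LinearMap.mem_ker, hcons]
        simp [Fin.tail_cons, hax y hy]
      · intro y hy c
        refine Fin.cases ?_ (fun j => ?_) c
        · simpa using hV1 (hY hy)
        · simpa using ha y hy j
      · intro y hy
        simp
      · intro v
        rw [LinearMap.mem_ker, hcons]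
        constructor
        · rintro ⟨u, hu, rfl⟩
          rw [hf]
          have hu : Fintype.linearCombination A z u = 0 := hu
          simp [Fin.tail_cons, hu]
        · rintro ⟨h, h0⟩
          have h0 : v 0 = 0 := h0
          rw [h0, zero_smul, zero_add] at h
          refine ⟨Fin.tail v, h, ?_⟩
          rw [hf, ← h0, Fin.cons_self_tail]
      · intro v hv
        rw [LinearMap.mem_ker, hcons] at hv
        rw [LinearMap.proj_apply, ← hcol, eq_neg_of_add_eq_zero_left hv, ← hspan,
          ← Fintype.range_linearCombination]
        exact Submodule.neg_mem _ ⟨_, rfl⟩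

/-- Needed so that the supremum defining the regularity is not taken over the empty set. -/
theorem exists_linear_resolution [GradedAlgebra 𝒜] (hV : V.Finite) (hV1 : V ⊆ 𝒜 1)
    (hcolon : HasLinearColonIdeals V) {Y : Set A} (hY : Y ⊆ V) :
    ∃ (F : MinimalGradedFreeResolution 𝒜 (quotientGrading 𝒜 (Ideal.span Y)))
      (b : Fin (F.rank 0)), F.deg 0 b = 0 := by
  let S := (r : ℕ) × {N : Submodule A (Fin r → A) // HasLinearQuotients 𝒜 V N}
  choose m z hz hspan hker using fun s : S => s.2.2.exists_cover hV hV1 hcolon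
  -- The state `s i` records the rank of the `i`-th free module and the submodule that becomes the
  -- image of the `i`-th differential. The next state is the kernel of a chosen cover.
  let s : ℕ → S := fun i => Nat.rec ⟨1, _, .comap_proj hV hV1 hcolon hY⟩
    (fun _ s => ⟨m s, _, hker s⟩) i
  have hrange : ∀ i, LinearMap.range (Fintype.linearCombination A (z (s i))) = (s i).2.1 :=
    fun i => (Fintype.range_linearCombination A _).trans (hspan (s i))
  have hsingle : ∀ i b, Fintype.linearCombination A (z (s i)) (Pi.single b 1) = z (s i) b := by
    intro i b
    rw [Fintype.linearCombination_apply_single, one_smul]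
  refine ⟨{
    rank := fun i => (s i).1
    deg := fun i _ => i
    aug := (Ideal.span Y).mkQ ∘ₗ LinearMap.proj 0
    d := fun i => Fintype.linearCombination A (z (s i))
    aug_surjective := ?_
    exact_aug := ?_
    exact_d := ?_
    aug_homogeneous := ?_
    d_homogeneous := ?_
    d_minimal := ?_ }, (0 : Fin 1), rfl⟩
  · exact (Submodule.mkQ_surjective _).comp fun a => ⟨fun _ => a, rfl⟩
  · rw [LinearMap.exact_iff, hrange, LinearMap.ker_comp, Submodule.ker_mkQ]
    rfl
  · intro i
    exact LinearMap.exact_iff.2 (hrange (i + 1)).symm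
  · intro b
    refine ⟨(Pi.single b 1 : Fin 1 → A) 0, ?_, rfl⟩
    have hb : b = (0 : Fin 1) := Subsingleton.elim (α := Fin 1) _ _
    rw [hb, Pi.single_eq_same]
    exact SetLike.GradedOne.one_mem (A := 𝒜)
  · intro i b c
    rw [hsingle]
    simpa using hz (s i) b c
  · intro i b c
    rw [hsingle]
    exact mem_positiveIdeal_of_mem one_pos (hz (s i) b c)

/-! ### Comparison of minimal resolutions -/

theorem linearMap_apply_eq_sum {r : ℕ} {M : Type*} [AddCommGroup M] [Module A M]
    (f : (Fin r → A) →ₗ[A] M) (x : Fin r → A) : f x = ∑ b, x b • f (Pi.single b 1) := by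
  rw [LinearMap.pi_apply_eq_sum_univ f x]
  refine Finset.sum_congr rfl fun b _ => ?_
  congr 2
  ext c
  simp [Pi.single_apply, eq_comm]

theorem apply_mem_of_degree_zero [GradedAlgebra 𝒜] {r m : ℕ} (f : (Fin r → A) →ₗ[A] (Fin m → A))
    (hf : ∀ b c, f (Pi.single b 1) c ∈ 𝒜 0) {i : ℤ} {x : Fin r → A} (hx : ∀ b, x b ∈ 𝒜 i)
    (c : Fin m) : f x c ∈ 𝒜 i := by
  rw [linearMap_apply_eq_sum, Finset.sum_apply]
  refine Submodule.sum_mem _ fun b _ => ?_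
  have := SetLike.GradedMul.mul_mem (A := 𝒜) (hx b) (hf b c)
  rwa [add_zero] at this

/-- The entries of `g ∘ f - id` have degree `0`, and by minimality they lie in the positive ideal,
so they vanish. -/
theorem comp_eq_id_of_minimal [GradedAlgebra 𝒜] (hneg : ∀ j < 0, 𝒜 j = ⊥) {M : Type*}
    [AddCommGroup M] [Module A M] {r m : ℕ} {p : (Fin r → A) →ₗ[A] M} {q : (Fin m → A) →ₗ[A] M}
    (hp : ∀ x, p x = 0 → ∀ b, x b ∈ positiveIdeal 𝒜) (f : (Fin r → A) →ₗ[A] (Fin m → A))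
    (g : (Fin m → A) →ₗ[A] (Fin r → A)) (hf : ∀ b c, f (Pi.single b 1) c ∈ 𝒜 0)
    (hg : ∀ b c, g (Pi.single b 1) c ∈ 𝒜 0) (hpq : ∀ x, p x = q (f x))
    (hqp : ∀ x, q x = p (g x)) : g ∘ₗ f = LinearMap.id := by
  have hsingle : ∀ b c, (Pi.single b 1 : Fin r → A) c ∈ 𝒜 0 := by
    intro b c
    rw [Pi.single_apply]
    split_ifs
    · exact SetLike.GradedOne.one_mem
    · exact Submodule.zero_mem _
  refine LinearMap.pi_ext' fun b => LinearMap.ext_ring (funext fun c => ?_)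
  refine sub_eq_zero.1 (eq_zero_of_mem_positiveIdeal 𝒜 hneg ?_ ?_)
  · refine hp (g (f (Pi.single b 1)) - Pi.single b 1) ?_ c
    rw [map_sub, ← hqp, ← hpq, sub_self]
  · exact Submodule.sub_mem _ (apply_mem_of_degree_zero g hg (hf b) c) (hsingle b c)

/-- Two minimal covers by free modules whose bases can be expressed in terms of each other with
coefficients of degree `0` are isomorphic. -/
theorem exists_equiv_of_minimal [GradedAlgebra 𝒜] (hneg : ∀ j < 0, 𝒜 j = ⊥) {M : Type*}
    [AddCommGroup M] [Module A M] {r m : ℕ} {p : (Fin r → A) →ₗ[A] M} {q : (Fin m → A) →ₗ[A] M}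
    (hp : ∀ x, p x = 0 → ∀ b, x b ∈ positiveIdeal 𝒜)
    (hq : ∀ x, q x = 0 → ∀ b, x b ∈ positiveIdeal 𝒜)
    (hpq : ∀ b, ∃ a : Fin m → A, (∀ c, a c ∈ 𝒜 0) ∧ q a = p (Pi.single b 1))
    (hqp : ∀ b, ∃ a : Fin r → A, (∀ c, a c ∈ 𝒜 0) ∧ p a = q (Pi.single b 1)) :
    ∃ e : (Fin r → A) ≃ₗ[A] (Fin m → A), (∀ x, q (e x) = p x) ∧
      (∀ i x, (∀ b, x b ∈ 𝒜 i) → ∀ c, e x c ∈ 𝒜 i) ∧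
      ∀ i x, (∀ b, x b ∈ 𝒜 i) → ∀ c, e.symm x c ∈ 𝒜 i := by
  choose a ha hap using hpq
  choose a' ha' haq using hqp
  let f := Fintype.linearCombination A a
  let g := Fintype.linearCombination A a'
  have hfs : ∀ b, f (Pi.single b 1) = a b := fun b => by
    rw [Fintype.linearCombination_apply_single, one_smul]
  have hgs : ∀ b, g (Pi.single b 1) = a' b := fun b => by
    rw [Fintype.linearCombination_apply_single, one_smul]
  have hpf : ∀ x, p x = q (f x) := by
    intro x
    rw [linearMap_apply_eq_sum p x, linearMap_apply_eq_sum f x, map_sum]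
    simp [hfs, hap]
  have hqg : ∀ x, q x = p (g x) := by
    intro x
    rw [linearMap_apply_eq_sum q x, linearMap_apply_eq_sum g x, map_sum]
    simp [hgs, haq]
  have hf : ∀ b c, f (Pi.single b 1) c ∈ 𝒜 0 := fun b => hfs b ▸ ha b
  have hg : ∀ b c, g (Pi.single b 1) c ∈ 𝒜 0 := fun b => hgs b ▸ ha' b
  refine ⟨LinearEquiv.ofLinearMap f g (comp_eq_id_of_minimal hneg hq g f hg hf hqg hpf)
    (comp_eq_id_of_minimal hneg hp f g hf hg hpf hqg), fun x => (hpf x).symm, ?_, ?_⟩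
  · exact fun i x hx c => apply_mem_of_degree_zero f hf hx c
  · exact fun i x hx c => apply_mem_of_degree_zero g hg hx c

section Minimal

variable {M : Type w} [AddCommGroup M] [Module A M] [Module k M] {ℳ : ℤ → Submodule k M}

theorem MinimalGradedFreeResolution.d_apply_mem_positiveIdeal
    (F : MinimalGradedFreeResolution 𝒜 ℳ) (i : ℕ) (x : Fin (F.rank (i + 1)) → A)
    (c : Fin (F.rank i)) : F.d i x c ∈ positiveIdeal 𝒜 := by
  rw [linearMap_apply_eq_sum, Finset.sum_apply]
  exact Ideal.sum_mem _ fun b _ => Ideal.mul_mem_left _ _ (F.d_minimal i b c)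

theorem MinimalGradedFreeResolution.mem_positiveIdeal_of_aug_eq_zero
    (F : MinimalGradedFreeResolution 𝒜 ℳ) (x : Fin (F.rank 0) → A) (hx : F.aug x = 0)
    (c : Fin (F.rank 0)) : x c ∈ positiveIdeal 𝒜 := by
  obtain ⟨y, rfl⟩ := (F.exact_aug x).1 hx
  exact F.d_apply_mem_positiveIdeal 0 y c

theorem MinimalGradedFreeResolution.mem_positiveIdeal_of_d_eq_zero
    (F : MinimalGradedFreeResolution 𝒜 ℳ) (i : ℕ) (x : Fin (F.rank (i + 1)) → A)
    (hx : F.d i x = 0) (c : Fin (F.rank (i + 1))) : x c ∈ positiveIdeal 𝒜 := by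
  obtain ⟨y, rfl⟩ := (F.exact_d i x).1 hx
  exact F.d_apply_mem_positiveIdeal (i + 1) y c

theorem map_single_ne_of_mem_positiveIdeal [GradedAlgebra 𝒜] [Nontrivial A] (hneg : ∀ j < 0, 𝒜 j = ⊥) {r : ℕ}
    {N : Type*} [AddCommGroup N] [Module A N] {p : (Fin r → A) →ₗ[A] N}
    (hp : ∀ x, p x = 0 → ∀ b, x b ∈ positiveIdeal 𝒜) (b : Fin r) {x : Fin r → A}
    (hx : x b ∈ positiveIdeal 𝒜) : p (Pi.single b 1) ≠ p x := by
  intro h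
  refine one_notMem_positiveIdeal 𝒜 hneg ?_
  have h1 := Ideal.add_mem _ (hp (Pi.single b 1 - x) (by rw [map_sub, h, sub_self]) b) hx
  simpa using h1

/-- If the image of the `i`-th differential is generated by vectors with linear entries, then the
next free module is generated in degree `i + 1`. -/
theorem MinimalGradedFreeResolution.exists_equiv_of_range_d [GradedAlgebra 𝒜] [Nontrivial A]
    (hneg : ∀ j < 0, 𝒜 j = ⊥) (F : MinimalGradedFreeResolution 𝒜 ℳ) (i : ℕ)
    (hdeg : ∀ b, F.deg i b = i) {m : ℕ} (z : Fin m → Fin (F.rank i) → A)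
    (hz : ∀ j c, z j c ∈ 𝒜 1) (hspan : Submodule.span A (Set.range z) = LinearMap.range (F.d i))
    (hker : ∀ x, Fintype.linearCombination A z x = 0 → ∀ b, x b ∈ positiveIdeal 𝒜) :
    (∀ b, F.deg (i + 1) b = i + 1) ∧
      ∃ e : (Fin (F.rank (i + 1)) → A) ≃ₗ[A] (Fin m → A),
        (∀ x, Fintype.linearCombination A z (e x) = F.d i x) ∧
        (∀ l x, (∀ b, x b ∈ 𝒜 l) → ∀ c, e x c ∈ 𝒜 l) ∧
        ∀ l x, (∀ b, x b ∈ 𝒜 l) → ∀ c, e.symm x c ∈ 𝒜 l := by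
  have hd0 := F.mem_positiveIdeal_of_d_eq_zero i
  have hcoeff : ∀ b, ∃ a : Fin m → A, (∀ j, a j ∈ 𝒜 (F.deg (i + 1) b - (i + 1))) ∧
      Fintype.linearCombination A z a = F.d i (Pi.single b 1) := by
    intro b
    refine exists_homogeneous_coefficients 𝒜 z (fun _ => (i : ℤ) + 1) (fun _ => i)
      (fun j c => by simpa using hz j c) (fun c => ?_) ?_
    · simpa [hdeg] using F.d_homogeneous i b c
    · rw [hspan]; exact ⟨_, rfl⟩
  have hlift : ∀ j, z j ∈ LinearMap.range (F.d i) := fun j =>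
    hspan ▸ Submodule.subset_span ⟨j, rfl⟩
  have hdeg' : ∀ b, F.deg (i + 1) b = i + 1 := by
    intro b
    obtain ⟨a, ha, hab⟩ := hcoeff b
    choose x hx using hlift
    -- In too small a degree the coefficients vanish and the basis vector maps to `0`. In too large
    -- a degree they are positive, so the basis vector is redundant. Minimality excludes both.
    rcases lt_trichotomy (F.deg (i + 1) b - (i + 1)) 0 with h | h | h
    · have ha0 : a = 0 := funext fun j => by simpa [hneg _ h] using ha j
      refine absurd ?_ (map_single_ne_of_mem_positiveIdeal hneg hd0 b (x := 0) (Submodule.zero_mem _))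
      rw [← hab, ha0, map_zero, map_zero]
    · omega
    · refine absurd ?_ (map_single_ne_of_mem_positiveIdeal hneg hd0 b (x := ∑ j, a j • x j) ?_)
      · rw [← hab, Fintype.linearCombination_apply, map_sum]
        simp [hx]
      · rw [Finset.sum_apply]
        exact Ideal.sum_mem _ fun j _ =>
          Ideal.mul_mem_right _ _ (mem_positiveIdeal_of_mem h (ha j))
  refine ⟨hdeg', exists_equiv_of_minimal hneg hd0 hker (fun b => ?_) fun j => ?_⟩
  · obtain ⟨a, ha, hab⟩ := hcoeff b
    exact ⟨a, by simpa [hdeg'] using ha, hab⟩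
  · have hdlc : Fintype.linearCombination A (fun b => F.d i (Pi.single b 1)) = F.d i := by
      refine LinearMap.ext fun x => ?_
      rw [Fintype.linearCombination_apply, ← linearMap_apply_eq_sum]
    have hmem : z j ∈ Submodule.span A (Set.range fun b => F.d i (Pi.single b 1)) := by
      rw [← Fintype.range_linearCombination, hdlc]
      exact hlift j
    obtain ⟨a, ha, haz⟩ := exists_homogeneous_coefficients 𝒜
      (fun b => F.d i (Pi.single b 1)) (fun _ => (i : ℤ) + 1) (fun _ => (i : ℤ)) (D := i + 1)
      (fun b c => by simpa [hdeg, hdeg'] using F.d_homogeneous i b c)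
      (fun c => by simpa using hz j c) hmem
    refine ⟨a, by simpa using ha, ?_⟩
    rw [← hdlc, haz, Fintype.linearCombination_apply_single, one_smul]

end Minimal

/-- The beginning of a minimal graded free resolution of `A ⧸ (Y)`. -/
theorem MinimalGradedFreeResolution.exists_equiv_of_quotient [GradedAlgebra 𝒜] [Nontrivial A]
    (hneg : ∀ j < 0, 𝒜 j = ⊥) {Y : Set A} (hY : Y ⊆ 𝒜 1)
    (F : MinimalGradedFreeResolution 𝒜 (quotientGrading 𝒜 (Ideal.span Y))) :
    (∀ b, F.deg 0 b = 0) ∧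
      ∃ e : (Fin (F.rank 0) → A) ≃ₗ[A] (Fin 1 → A),
        (∀ x, x ∈ LinearMap.range (F.d 0) ↔ e x 0 ∈ Ideal.span Y) ∧
        (∀ l x, (∀ b, x b ∈ 𝒜 l) → ∀ c, e x c ∈ 𝒜 l) ∧
        ∀ l x, (∀ b, x b ∈ 𝒜 l) → ∀ c, e.symm x c ∈ 𝒜 l := by
  have hd0 := F.mem_positiveIdeal_of_aug_eq_zero
  choose a ha haug using F.aug_homogeneous
  have haug : ∀ b, Ideal.Quotient.mk (Ideal.span Y) (a b) = F.aug (Pi.single b 1) := haug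
  obtain ⟨f, hf⟩ := F.aug_surjective 1
  have hdeg : ∀ b, F.deg 0 b = 0 := by
    intro b
    rcases lt_trichotomy (F.deg 0 b) 0 with h | h | h
    · have ha0 : a b = 0 := by simpa [hneg _ h] using ha b
      refine absurd ?_ (map_single_ne_of_mem_positiveIdeal hneg hd0 b (x := 0) (Submodule.zero_mem _))
      rw [← haug, ha0, map_zero, map_zero]
    · exact h
    · refine absurd ?_ (map_single_ne_of_mem_positiveIdeal hneg hd0 b (x := a b • f) ?_)
      · rw [map_smul, hf, ← haug, Algebra.smul_def, mul_one]
        rfl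
      · exact Ideal.mul_mem_right _ _ (mem_positiveIdeal_of_mem h (ha b))
  simp only [hdeg] at ha
  let q : (Fin 1 → A) →ₗ[A] A ⧸ Ideal.span Y := (Ideal.span Y).mkQ ∘ₗ LinearMap.proj 0
  have hq : ∀ x, q x = Ideal.Quotient.mk (Ideal.span Y) (x 0) := fun x => rfl
  have hq0 : ∀ x, q x = 0 ↔ x 0 ∈ Ideal.span Y := fun x => by
    rw [hq, Ideal.Quotient.eq_zero_iff_mem]
  obtain ⟨e, heq, he, he'⟩ := exists_equiv_of_minimal hneg hd0 (q := q)
    (fun x hx b => by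
      rw [Subsingleton.elim b 0]
      exact span_le_positiveIdeal 𝒜 hY ((hq0 x).1 hx))
    (fun b => ⟨fun _ => a b, fun _ => ha b, haug b⟩)
    (fun b => by
      refine ⟨fun c => GradedAlgebra.proj 𝒜 0 (f c), fun c => proj_mem 𝒜 _ _, ?_⟩
      have hsum : ∀ x, F.aug x = Ideal.Quotient.mk (Ideal.span Y) (∑ c, x c * a c) := by
        intro x
        rw [linearMap_apply_eq_sum, map_sum]
        refine Finset.sum_congr rfl fun c _ => ?_
        rw [← haug, map_mul]
        rfl
      rw [hsum, hq, Subsingleton.elim b 0, Pi.single_eq_same]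
      congr 1
      have h1 : ∑ c, f c * a c - 1 ∈ Ideal.span Y := by
        rw [← Ideal.Quotient.eq_zero_iff_mem, map_sub, ← hsum, hf, map_one, sub_self]
      have h2 := proj_zero_of_mem_positiveIdeal 𝒜 hneg (span_le_positiveIdeal 𝒜 hY h1)
      rw [map_sub, proj_of_mem 𝒜 SetLike.GradedOne.one_mem, sub_eq_zero, map_sum] at h2
      rw [← h2]
      exact Finset.sum_congr rfl fun c _ =>
        (proj_mul_of_right_mem 𝒜 (add_zero 0) (f c) (ha c)).symm)
  refine ⟨hdeg, e, fun x => ?_, he, he'⟩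
  rw [← hq0, heq, F.exact_aug x]
  rfl

theorem HasLinearQuotients.apply_mem_positiveIdeal {r : ℕ} {N : Submodule A (Fin r → A)}
    (hN : HasLinearQuotients 𝒜 V N) {x : Fin r → A} (hx : x ∈ N) (c : Fin r) :
    x c ∈ positiveIdeal 𝒜 := by
  suffices h : N ≤ Submodule.comap (LinearMap.proj (φ := fun _ : Fin r => A) c) (positiveIdeal 𝒜)
    from h hx
  clear hx x
  induction hN with
  | bot => exact bot_le
  | sup_span _ hz _ _ ih =>
    refine sup_le ih ((Submodule.span_singleton_le_iff_mem _ _).2 ?_)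
    exact mem_positiveIdeal_of_mem one_pos (hz c)

theorem map_symm_eq_of_mem_iff {M N : Type*} [AddCommGroup M] [Module A M] [AddCommGroup N]
    [Module A N] (e : M ≃ₗ[A] N) {P : Submodule A M} {Q : Submodule A N}
    (h : ∀ x, x ∈ P ↔ e x ∈ Q) : Q.map (e.symm : N →ₗ[A] M) = P := by
  ext x
  rw [h]
  constructor
  · rintro ⟨y, hy, rfl⟩
    simpa using hy
  · exact fun hx => ⟨e x, hx, by simp⟩

/-- Over a ring in which colon ideals of coordinate ideals are coordinate ideals, all minimal graded
free resolutions of quotients by coordinate ideals are linear. -/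
theorem MinimalGradedFreeResolution.deg_eq_of_hasLinearColonIdeals [GradedAlgebra 𝒜] [Nontrivial A]
    (hneg : ∀ j < 0, 𝒜 j = ⊥) (hV : V.Finite) (hV1 : V ⊆ 𝒜 1) (hcolon : HasLinearColonIdeals V)
    {Y : Set A} (hY : Y ⊆ V)
    (F : MinimalGradedFreeResolution 𝒜 (quotientGrading 𝒜 (Ideal.span Y))) (i : ℕ)
    (b : Fin (F.rank i)) : F.deg i b = i := by
  suffices h : (∀ b, F.deg i b = i) ∧ HasLinearQuotients 𝒜 V (LinearMap.range (F.d i)) from h.1 b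
  clear b
  induction i with
  | zero =>
    obtain ⟨hdeg, e, he, -, he'⟩ := F.exists_equiv_of_quotient hneg (hY.trans hV1)
    refine ⟨by simpa using hdeg, ?_⟩
    have h := (HasLinearQuotients.comap_proj hV hV1 hcolon hY).map
      (e.symm : (Fin 1 → A) →ₗ[A] (Fin (F.rank 0) → A)) e.symm.injective (he' 1)
    rwa [map_symm_eq_of_mem_iff e he] at h
  | succ i ih =>
    obtain ⟨hdeg, hquot⟩ := ih
    obtain ⟨m, z, hz, hspan, hker⟩ := hquot.exists_cover hV hV1 hcolon
    obtain ⟨hdeg', e, he, -, he'⟩ := F.exists_equiv_of_range_d hneg i hdeg z hz hspan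
      fun x hx => hker.apply_mem_positiveIdeal (LinearMap.mem_ker.2 hx)
    refine ⟨by simpa using hdeg', ?_⟩
    have h := hker.map (e.symm : (Fin m → A) →ₗ[A] (Fin (F.rank (i + 1)) → A)) e.symm.injective
      (he' 1)
    rwa [map_symm_eq_of_mem_iff e fun x => (by rw [LinearMap.mem_ker, LinearMap.mem_ker, he] :
      x ∈ LinearMap.ker (F.d i) ↔ _), LinearMap.exact_iff.1 (F.exact_d i)] at h

theorem castelnuovoMumfordRegularity_quotient_eq_zero [GradedAlgebra 𝒜] [Nontrivial A]
    (hneg : ∀ j < 0, 𝒜 j = ⊥) (hV : V.Finite) (hV1 : V ⊆ 𝒜 1) (hcolon : HasLinearColonIdeals V)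
    {Y : Set A} (hY : Y ⊆ V) :
    castelnuovoMumfordRegularity 𝒜 (quotientGrading 𝒜 (Ideal.span Y)) = 0 := by
  refine le_antisymm (sSup_le ?_) (le_sSup ?_)
  · rintro _ ⟨F, i, b, rfl⟩
    simp [F.deg_eq_of_hasLinearColonIdeals hneg hV hV1 hcolon hY i b]
  · obtain ⟨F, b, hb⟩ := exists_linear_resolution hV hV1 hcolon hY
    exact ⟨F, 0, b, by simp [hb]⟩

/-- If `A ⧸ (y)` has regularity `0`, then the syzygies of `y` are generated in degree at most
`1`. -/
theorem ker_linearCombination_le_of_regularity_eq_zero [GradedAlgebra 𝒜] [Nontrivial A]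
    (hneg : ∀ j < 0, 𝒜 j = ⊥) {m : ℕ} (y : Fin m → A) (hy : ∀ j, y j ∈ 𝒜 1)
    (hker : ∀ x, Fintype.linearCombination A y x = 0 → ∀ b, x b ∈ positiveIdeal 𝒜)
    (hreg : castelnuovoMumfordRegularity 𝒜 (quotientGrading 𝒜 (Ideal.span (Set.range y))) = 0) :
    LinearMap.ker (Fintype.linearCombination A y) ≤
      Submodule.span A {x | Fintype.linearCombination A y x = 0 ∧ ∃ l ≤ 1, ∀ j, x j ∈ 𝒜 l} := by
  obtain ⟨F, hF⟩ : ∃ F : MinimalGradedFreeResolution 𝒜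
      (quotientGrading 𝒜 (Ideal.span (Set.range y))), ∀ i b, F.deg i b ≤ i := by
    rw [castelnuovoMumfordRegularity] at hreg
    obtain ⟨_, F, _⟩ : Set.Nonempty {x | ∃ (F : MinimalGradedFreeResolution 𝒜
        (quotientGrading 𝒜 (Ideal.span (Set.range y)))) (i : ℕ) (b : Fin (F.rank i)),
        x = (((F.deg i b - (i : ℤ) : ℤ) : ℝ) : EReal)} := by
      by_contra h
      -- Regularity `0` itself provides a resolution, because the empty supremum is `⊥`.
      rw [Set.not_nonempty_iff_eq_empty.1 h, sSup_empty] at hreg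
      exact EReal.bot_ne_zero hreg
    refine ⟨F, fun i b => ?_⟩
    have h := (le_sSup (Set.mem_ofPred.2 ⟨F, i, b, rfl⟩)).trans_eq hreg
    have h : ((F.deg i b - (i : ℤ) : ℤ) : ℝ) ≤ 0 := by exact_mod_cast h
    have h : F.deg i b - (i : ℤ) ≤ 0 := by exact_mod_cast h
    omega
  obtain ⟨hdeg, e, he, -, he'⟩ := F.exists_equiv_of_quotient hneg
    (Set.range_subset_iff.2 hy : Set.range y ⊆ 𝒜 1)
  let z : Fin m → Fin (F.rank 0) → A := fun j => e.symm fun _ => y j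
  have hlc : ∀ x, Fintype.linearCombination A z x =
      e.symm fun _ => Fintype.linearCombination A y x := by
    intro x
    rw [Fintype.linearCombination_apply, Fintype.linearCombination_apply]
    simp only [z, ← map_smul, ← map_sum]
    congr 1
    ext c
    simp
  have hlc0 : ∀ x, Fintype.linearCombination A z x = 0 ↔ Fintype.linearCombination A y x = 0 := by
    intro x
    rw [hlc, LinearEquiv.map_eq_zero_iff]
    exact ⟨fun h => congrFun h 0, fun h => by rw [h]; rfl⟩
  have hmem : ∀ a, a ∈ Ideal.span (Set.range y) ↔ ∃ x, Fintype.linearCombination A y x = a := by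
    intro a
    rw [← Ideal.submodule_span_eq, ← Fintype.range_linearCombination]
    rfl
  have hspan : Submodule.span A (Set.range z) = LinearMap.range (F.d 0) := by
    ext x
    rw [he, ← Fintype.range_linearCombination]
    constructor
    · rintro ⟨a, rfl⟩
      rw [hlc, LinearEquiv.apply_symm_apply]
      exact (hmem _).2 ⟨a, rfl⟩
    · intro h
      obtain ⟨a, ha⟩ := (hmem _).1 h
      refine ⟨a, ?_⟩
      rw [hlc, ha, LinearEquiv.symm_apply_eq]
      ext c
      rw [Subsingleton.elim c 0]
  obtain ⟨hdeg', e', hd, he₁, -⟩ := F.exists_equiv_of_range_d hneg 0 (by simpa using hdeg) z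
    (fun j => he' 1 _ fun _ => hy j) hspan fun x hx => hker x ((hlc0 x).1 hx)
  intro x hx
  have hx0 : F.d 0 (e'.symm x) = 0 := by
    rw [← hd, LinearEquiv.apply_symm_apply, hlc0]
    exact hx
  obtain ⟨a, ha⟩ := (F.exact_d 0 _).1 hx0
  rw [← e'.apply_symm_apply x, ← ha, linearMap_apply_eq_sum, map_sum]
  refine Submodule.sum_mem _ fun b _ => ?_
  rw [map_smul]
  -- A basis vector of the second free module has degree at most `2`, and the first free module
  -- lives in degree `1`. Hence the shift by `1`.
  refine Submodule.smul_mem _ _ (Submodule.subset_span ⟨?_, F.deg 2 b - 1, ?_, ?_⟩)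
  · rw [← hlc0, hd]
    exact (F.exact_d 0 _).2 ⟨_, rfl⟩
  · have := hF 2 b
    push_cast at this
    omega
  · refine he₁ _ _ fun c => ?_
    have := F.d_homogeneous 1 b c
    rwa [hdeg'] at this

end LinearResolutions

/-! ### Multidegrees and straightening of monomials -/

section ScrollMonoid

variable {t : ℕ} {n : Fin t → ℕ}

/-- The sum of the positions of the variables in a monomial. -/
def scrollWeight (s : Multiset (ScrollVar n)) : ℕ := (s.map fun v => (v.2 : ℕ)).sum

@[simp]
theorem scrollWeight_cons (v : ScrollVar n) (s : Multiset (ScrollVar n)) :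
    scrollWeight (v ::ₘ s) = v.2 + scrollWeight s := by
  simp [scrollWeight]

theorem scrollWeight_le (s : Multiset (ScrollVar n)) :
    scrollWeight s ≤ ((s.map Sigma.fst).map n).sum := by
  rw [Multiset.map_map]
  exact Multiset.sum_map_le_sum_map _ _ fun v _ => Nat.lt_succ_iff.1 v.2.2

section Straightening

variable {B : Type*} [CommMonoid B] {f : ScrollVar n → B}

/-- Each minor relation moves one unit of position from a variable of `s` to the chosen variable of
block `i`; `hs` says that `s` has enough units to give. -/
theorem exists_raise (hf : ∀ (i j : Fin t) (p : Fin (n i)) (q : Fin (n j)),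
    f ⟨i, p.castSucc⟩ * f ⟨j, q.succ⟩ = f ⟨j, q.castSucc⟩ * f ⟨i, p.succ⟩)
    (i : Fin t) (d : ℕ) (p q : Fin (n i + 1)) (hpq : (p : ℕ) + d = q) (s : Multiset (ScrollVar n))
    (hs : (q : ℕ) ≤ p + scrollWeight s) :
    ∃ s', f ⟨i, p⟩ * (s.map f).prod = f ⟨i, q⟩ * (s'.map f).prod ∧
      s'.map Sigma.fst = s.map Sigma.fst ∧ q + scrollWeight s' = p + scrollWeight s := by
  induction d generalizing p s with
  | zero =>
    obtain rfl : p = q := Fin.ext hpq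
    exact ⟨s, rfl, rfl, rfl⟩
  | succ d ih =>
    obtain ⟨⟨j, r⟩, hw, hr⟩ : ∃ w ∈ s, (w.2 : ℕ) ≠ 0 := by
      by_contra! h
      have : scrollWeight s = 0 := by
        rw [scrollWeight, Multiset.map_congr rfl h]
        simp
      omega
    obtain ⟨s, rfl⟩ := Multiset.exists_cons_of_mem hw
    obtain ⟨r, rfl⟩ := Fin.exists_succ_eq.2 (fun h => hr (by simp [h]) : r ≠ 0)
    have hp : (p : ℕ) < n i := by omega
    obtain ⟨p, rfl⟩ : ∃ p' : Fin (n i), p = p'.castSucc := ⟨⟨p, hp⟩, rfl⟩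
    obtain ⟨s', hs', hfst, hwt⟩ := ih p.succ (by simp at hpq ⊢; omega) (⟨j, r.castSucc⟩ ::ₘ s)
      (by simp at hs ⊢; omega)
    refine ⟨s', ?_, by simpa using hfst, ?_⟩
    · rw [← hs']
      simp only [Multiset.map_cons, Multiset.prod_cons]
      rw [← mul_assoc, hf, ← mul_assoc, mul_comm (f ⟨j, _⟩)]
    · simp at hwt ⊢
      omega

/-- The mirror image of `exists_raise`: units move into `s`, and `hs` says that its blocks have room
for them. -/
theorem exists_lower (hf : ∀ (i j : Fin t) (p : Fin (n i)) (q : Fin (n j)),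
    f ⟨i, p.castSucc⟩ * f ⟨j, q.succ⟩ = f ⟨j, q.castSucc⟩ * f ⟨i, p.succ⟩)
    (i : Fin t) (d : ℕ) (p q : Fin (n i + 1)) (hpq : (q : ℕ) + d = p) (s : Multiset (ScrollVar n))
    (hs : p + scrollWeight s ≤ q + ((s.map Sigma.fst).map n).sum) :
    ∃ s', f ⟨i, p⟩ * (s.map f).prod = f ⟨i, q⟩ * (s'.map f).prod ∧
      s'.map Sigma.fst = s.map Sigma.fst ∧ q + scrollWeight s' = p + scrollWeight s := by
  induction d generalizing p s with
  | zero =>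
    obtain rfl : q = p := Fin.ext hpq
    exact ⟨s, rfl, rfl, rfl⟩
  | succ d ih =>
    obtain ⟨⟨j, r⟩, hw, hr⟩ : ∃ w ∈ s, (w.2 : ℕ) < n w.1 := by
      by_contra! h
      have : ((s.map Sigma.fst).map n).sum ≤ scrollWeight s := by
        rw [Multiset.map_map]
        exact Multiset.sum_map_le_sum_map _ _ h
      omega
    obtain ⟨s, rfl⟩ := Multiset.exists_cons_of_mem hw
    obtain ⟨r, rfl⟩ : ∃ r' : Fin (n j), r = r'.castSucc := ⟨⟨r, hr⟩, rfl⟩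
    obtain ⟨p, rfl⟩ := Fin.exists_succ_eq.2 (fun h => by simp [h] at hpq : p ≠ 0)
    obtain ⟨s', hs', hfst, hwt⟩ := ih p.castSucc (by simp at hpq ⊢; omega) (⟨j, r.succ⟩ ::ₘ s)
      (by simp at hs ⊢; omega)
    refine ⟨s', ?_, by simpa using hfst, ?_⟩
    · rw [← hs']
      simp only [Multiset.map_cons, Multiset.prod_cons]
      rw [← mul_assoc, ← mul_assoc, hf, mul_comm (f ⟨j, _⟩)]
    · simp at hwt ⊢
      omega

/-- Modulo the minors of the scroll matrix, a monomial depends only on its multidegree. -/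
theorem prod_eq_prod_of_scrollWeight_eq (hf : ∀ (i j : Fin t) (p : Fin (n i)) (q : Fin (n j)),
    f ⟨i, p.castSucc⟩ * f ⟨j, q.succ⟩ = f ⟨j, q.castSucc⟩ * f ⟨i, p.succ⟩)
    (s s' : Multiset (ScrollVar n)) (hfst : s.map Sigma.fst = s'.map Sigma.fst)
    (hwt : scrollWeight s = scrollWeight s') : (s.map f).prod = (s'.map f).prod := by
  induction s' using Multiset.induction_on generalizing s with
  | empty =>
    rw [Multiset.map_zero, Multiset.map_eq_zero] at hfst
    rw [hfst]
  | cons v s' ih =>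
    obtain ⟨i, q⟩ := v
    obtain ⟨⟨j, p⟩, hw, hij⟩ : ∃ w ∈ s, w.1 = i := by
      rw [← Multiset.mem_map, hfst]
      simp
    obtain rfl : j = i := hij
    obtain ⟨s, rfl⟩ := Multiset.exists_cons_of_mem hw
    simp only [Multiset.map_cons, Multiset.cons_inj_right, scrollWeight_cons] at hfst hwt
    -- Both monomials contain a variable of block `j`. Moving the one in `s` to position `q` lets
    -- this common factor be split off.
    have key : ∃ s'', f ⟨j, p⟩ * (s.map f).prod = f ⟨j, q⟩ * (s''.map f).prod ∧
        s''.map Sigma.fst = s.map Sigma.fst ∧ q + scrollWeight s'' = p + scrollWeight s := by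
      rcases le_total (p : ℕ) q with h | h
      · exact exists_raise hf j _ p q (Nat.add_sub_cancel' h) s (by omega)
      · refine exists_lower hf j _ p q (Nat.add_sub_cancel' h) s ?_
        have := scrollWeight_le s'
        rw [hfst]
        omega
    obtain ⟨s'', hs'', hfst', hwt'⟩ := key
    rw [Multiset.map_cons, Multiset.prod_cons, hs'', ih s'' (hfst'.trans hfst) (by omega),
      Multiset.map_cons, Multiset.prod_cons]

end Straightening

variable (n) in
/-- The monoid of multidegrees of the monomials of the rational normal scroll of type `n`. -/
def scrollMonoid : AddSubmonoid (Multiset (Fin t) × ℕ) where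
  carrier := {x | x.2 ≤ (x.1.map n).sum}
  zero_mem' := by simp
  add_mem' {x y} hx hy := by
    simp only [Set.mem_ofPred_eq] at hx hy
    simpa using add_le_add hx hy

theorem mem_scrollMonoid {x : Multiset (Fin t) × ℕ} :
    x ∈ scrollMonoid n ↔ x.2 ≤ (x.1.map n).sum := Iff.rfl

/-- The multidegree of a variable. -/
def scrollPoint (v : ScrollVar n) : scrollMonoid n :=
  ⟨({v.1}, v.2), by simpa [mem_scrollMonoid] using Nat.lt_succ_iff.1 v.2.2⟩

theorem scrollPoint_injective : Function.Injective (scrollPoint (n := n)) := by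
  rintro ⟨i, p⟩ ⟨j, q⟩ h
  simp only [scrollPoint, Subtype.mk.injEq, Prod.mk.injEq, Multiset.singleton_inj] at h
  obtain ⟨rfl, h⟩ := h
  rw [Fin.ext h]

theorem coe_sum_map_scrollPoint (s : Multiset (ScrollVar n)) :
    ((s.map scrollPoint).sum : Multiset (Fin t) × ℕ) = (s.map Sigma.fst, scrollWeight s) := by
  induction s using Multiset.induction_on with
  | empty => rfl
  | cons v s ih => simp [ih, scrollPoint]

theorem exists_sum_map_scrollPoint (x : scrollMonoid n) :
    ∃ s : Multiset (ScrollVar n), (s.map scrollPoint).sum = x := by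
  obtain ⟨⟨α, a⟩, hx⟩ := x
  suffices h : ∃ s : Multiset (ScrollVar n), s.map Sigma.fst = α ∧ scrollWeight s = a by
    obtain ⟨s, h1, h2⟩ := h
    exact ⟨s, Subtype.ext (by rw [coe_sum_map_scrollPoint, h1, h2])⟩
  replace hx : a ≤ (α.map n).sum := hx
  induction α using Multiset.induction_on generalizing a with
  | empty => exact ⟨0, by simp, by simpa [scrollWeight, eq_comm] using hx⟩
  | cons i α ih =>
    rw [Multiset.map_cons, Multiset.sum_cons] at hx
    -- Greedy filling: the variable of block `i` takes as much of the weight as it can hold.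
    obtain ⟨s, h1, h2⟩ := ih (a - min a (n i)) (by omega)
    refine ⟨⟨i, ⟨min a (n i), by omega⟩⟩ ::ₘ s, by simp [h1], ?_⟩
    simp only [scrollWeight_cons, h2]
    omega

variable (n) in
/-- The degree of a monomial. -/
def scrollDegree : scrollMonoid n →+ ℤ :=
  ((Nat.castAddMonoidHom ℤ).comp (Multiset.cardHom.comp (AddMonoidHom.fst _ _))).comp
    (scrollMonoid n).subtype

theorem scrollDegree_apply (x : scrollMonoid n) : scrollDegree n x = (x.1.1.card : ℤ) := rfl

end ScrollMonoid

/-! ### The scroll as a monoid algebra -/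

section ScrollAlgebra

variable {k : Type u} [CommRing k] {t : ℕ} {n : Fin t → ℕ}

variable (k) in
/-- The natural coordinate of the scroll with a given index. -/
def scrollCoordinate (v : ScrollVar n) : Scroll k n := Ideal.Quotient.mk _ (MvPolynomial.X v)

theorem scrollCoordinate_mul_scrollCoordinate (i j : Fin t) (p : Fin (n i)) (q : Fin (n j)) :
    scrollCoordinate k (⟨i, p.castSucc⟩ : ScrollVar n) * scrollCoordinate k ⟨j, q.succ⟩ =
      scrollCoordinate k ⟨j, q.castSucc⟩ * scrollCoordinate k ⟨i, p.succ⟩ := by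
  simp only [scrollCoordinate, ← map_mul]
  rw [Ideal.Quotient.eq]
  refine Ideal.subset_span ⟨⟨i, p⟩, ⟨j, q⟩, ?_⟩
  rw [Matrix.det_fin_two]
  simp [scrollMatrix]

variable (k n) in
/-- The monomial parametrization of the scroll. -/
def scrollParametrization :
    MvPolynomial (ScrollVar n) k →ₐ[k] AddMonoidAlgebra k (scrollMonoid n) :=
  MvPolynomial.aeval fun v => AddMonoidAlgebra.single (scrollPoint v) 1

theorem scrollParametrization_X (v : ScrollVar n) :
    scrollParametrization k n (MvPolynomial.X v) = AddMonoidAlgebra.single (scrollPoint v) 1 :=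
  MvPolynomial.aeval_X _ _

theorem scrollParametrization_eq_zero (f : MvPolynomial (ScrollVar n) k)
    (hf : f ∈ idealOfTwoMinors (scrollMatrix k n)) : scrollParametrization k n f = 0 := by
  suffices h : idealOfTwoMinors (scrollMatrix k n) ≤ RingHom.ker (scrollParametrization k n) from
    h hf
  refine Ideal.span_le.2 ?_
  rintro _ ⟨⟨i, p⟩, ⟨j, q⟩, rfl⟩
  rw [SetLike.mem_coe, RingHom.mem_ker, Matrix.det_fin_two]
  simp only [scrollMatrix, Matrix.submatrix_apply, id_eq, Matrix.cons_val_zero, Matrix.cons_val_one,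
    Matrix.of_apply, map_sub, map_mul, scrollParametrization_X, AddMonoidAlgebra.single_mul_single]
  rw [sub_eq_zero]
  congr 1
  refine Subtype.ext (Prod.ext ?_ ?_)
  · exact add_comm _ _
  · simp [scrollPoint]
    omega

theorem prod_map_single_scrollPoint (s : Multiset (ScrollVar n)) :
    (s.map fun v => AddMonoidAlgebra.single (R := k) (scrollPoint v) 1).prod =
      AddMonoidAlgebra.single (s.map scrollPoint).sum 1 := by
  induction s using Multiset.induction_on with
  | empty => rfl
  | cons v s ih => simp [ih, AddMonoidAlgebra.single_mul_single]

theorem prod_map_scrollCoordinate_eq {s s' : Multiset (ScrollVar n)}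
    (h : (s.map scrollPoint).sum = (s'.map scrollPoint).sum) :
    (s.map (scrollCoordinate k)).prod = (s'.map (scrollCoordinate k)).prod := by
  have h' := congrArg Subtype.val h
  rw [coe_sum_map_scrollPoint, coe_sum_map_scrollPoint, Prod.mk.injEq] at h'
  exact prod_eq_prod_of_scrollWeight_eq scrollCoordinate_mul_scrollCoordinate s s' h'.1 h'.2

variable (k n) in
/-- The class of the monomials with a given multidegree. -/
def scrollMonomial : Multiplicative (scrollMonoid n) →* Scroll k n where
  toFun x := ((exists_sum_map_scrollPoint x.toAdd).choose.map (scrollCoordinate k)).prod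
  map_one' := by
    rw [prod_map_scrollCoordinate_eq (s' := 0)]
    · simp
    · rw [(exists_sum_map_scrollPoint _).choose_spec]
      simp
  map_mul' x y := by
    rw [← Multiset.prod_add, ← Multiset.map_add]
    refine prod_map_scrollCoordinate_eq ?_
    rw [Multiset.map_add, Multiset.sum_add]
    simp only [(exists_sum_map_scrollPoint _).choose_spec]
    rfl

theorem scrollMonomial_sum (s : Multiset (ScrollVar n)) :
    scrollMonomial k n (Multiplicative.ofAdd (s.map scrollPoint).sum) =
      (s.map (scrollCoordinate k)).prod :=
  prod_map_scrollCoordinate_eq (exists_sum_map_scrollPoint _).choose_spec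

variable (k n) in
/-- The scroll is the monoid algebra of the monoid of its multidegrees. -/
def scrollEquiv : Scroll k n ≃ₐ[k] AddMonoidAlgebra k (scrollMonoid n) :=
  AlgEquiv.ofAlgHom
    (Ideal.Quotient.liftₐ _ (scrollParametrization k n) scrollParametrization_eq_zero)
    (AddMonoidAlgebra.lift k (Scroll k n) (scrollMonoid n) (scrollMonomial k n))
    (by
      refine AddMonoidAlgebra.algHom_ext (fun x => ?_) (Subsingleton.elim _ _)
      obtain ⟨s, rfl⟩ := exists_sum_map_scrollPoint x
      rw [AlgHom.comp_apply, AddMonoidAlgebra.lift_single, one_smul, scrollMonomial_sum,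
        map_multiset_prod, Multiset.map_map, AlgHom.id_apply, ← prod_map_single_scrollPoint]
      refine congrArg Multiset.prod (Multiset.map_congr rfl fun v _ => ?_)
      exact scrollParametrization_X v)
    (by
      refine Ideal.Quotient.algHom_ext _ (MvPolynomial.algHom_ext fun v => ?_)
      have h := scrollMonomial_sum (k := k) {v}
      rw [Multiset.map_singleton, Multiset.sum_singleton, Multiset.map_singleton,
        Multiset.prod_singleton] at h
      refine Eq.trans ?_ h
      refine (congrArg (AddMonoidAlgebra.lift k (Scroll k n) (scrollMonoid n) (scrollMonomial k n))
        (scrollParametrization_X v)).trans ?_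
      rw [AddMonoidAlgebra.lift_single, one_smul])

theorem scrollEquiv_scrollCoordinate (v : ScrollVar n) :
    scrollEquiv k n (scrollCoordinate k v) = AddMonoidAlgebra.single (scrollPoint v) 1 :=
  scrollParametrization_X v

end ScrollAlgebra

/-! ### The grading, colon ideals and the two directions -/

section ScrollGrading

variable {k : Type u} [CommRing k] {t : ℕ} {n : Fin t → ℕ}

theorem monomial_toFinsupp {σ : Type*} [DecidableEq σ] (s : Multiset σ) (c : k) :
    MvPolynomial.monomial (Multiset.toFinsupp s) c =
      c • (s.map (MvPolynomial.X (R := k))).prod := by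
  induction s using Multiset.induction_on with
  | empty => simp [MvPolynomial.smul_eq_C_mul]
  | cons v s ih =>
    rw [← Multiset.singleton_add, Multiset.toFinsupp_add, Multiset.toFinsupp_singleton,
      MvPolynomial.monomial_single_add, ih, pow_one, Multiset.singleton_add, Multiset.map_cons,
      Multiset.prod_cons, mul_smul_comm]

theorem scrollParametrization_monomial (s : Multiset (ScrollVar n)) (c : k) :
    scrollParametrization k n (MvPolynomial.monomial (Multiset.toFinsupp s) c) =
      AddMonoidAlgebra.single (s.map scrollPoint).sum c := by
  rw [monomial_toFinsupp, map_smul, map_multiset_prod, Multiset.map_map]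
  simp only [Function.comp_def, scrollParametrization_X]
  rw [prod_map_single_scrollPoint, AddMonoidAlgebra.smul_single', mul_one]

theorem scrollDegree_sum (s : Multiset (ScrollVar n)) :
    scrollDegree n (s.map scrollPoint).sum = (s.card : ℤ) := by
  rw [scrollDegree_apply, coe_sum_map_scrollPoint, Multiset.card_map]

/-- A polynomial monomial of degree `m` maps to a monoid element of degree `m`, and every monoid
element arises this way. This transports the direct sum decomposition of the monoid algebra to the
scroll. -/
theorem mem_scrollGrading_iff (j : ℤ) (a : Scroll k n) :
    a ∈ scrollGrading k n j ↔
      scrollEquiv k n a ∈ AddMonoidAlgebra.gradeBy k (scrollDegree n) j := by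
  have hcard : ∀ s : Multiset (ScrollVar n), (Multiset.toFinsupp s).degree = s.card := by
    intro s
    rw [← Multiset.toFinsupp_sum_eq]
    rfl
  constructor
  · rintro ⟨f, hf, rfl⟩
    change scrollParametrization k n f ∈ _
    obtain m | m := j
    · have hf : f.IsHomogeneous m := hf
      rw [f.as_sum, map_sum]
      refine Submodule.sum_mem _ fun d hd => ?_
      obtain ⟨s, rfl⟩ := Multiset.toFinsupp.surjective d
      have hs : s.card = m := by
        rw [← hcard, Finsupp.degree_eq_weight_one]
        exact hf (MvPolynomial.mem_support_iff.1 hd)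
      rw [scrollParametrization_monomial, ← hs]
      have h := AddMonoidAlgebra.single_mem_gradeBy (scrollDegree n) (s.map scrollPoint).sum
        (f.coeff (Multiset.toFinsupp s))
      rwa [scrollDegree_sum] at h
    · have hf : f ∈ (⊥ : Submodule k _) := hf
      rw [(Submodule.mem_bot k).1 hf, map_zero]
      exact Submodule.zero_mem _
  · intro h
    suffices h' : ∀ x : AddMonoidAlgebra k (scrollMonoid n),
        x ∈ AddMonoidAlgebra.gradeBy k (scrollDegree n) j →
          (scrollEquiv k n).symm x ∈ scrollGrading k n j by
      simpa using h' _ h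
    intro x hx
    rw [← x.sum_coeff_single, Finsupp.sum, map_sum]
    refine Submodule.sum_mem _ fun y hy => ?_
    obtain ⟨s, rfl⟩ := exists_sum_map_scrollPoint y
    have hj := hx _ hy
    rw [scrollDegree_sum] at hj
    subst hj
    refine ⟨MvPolynomial.monomial (Multiset.toFinsupp s) (x.coeff (s.map scrollPoint).sum),
      MvPolynomial.isHomogeneous_monomial _ (hcard s), ?_⟩
    rw [AlgEquiv.eq_symm_apply]
    exact scrollParametrization_monomial s _

instance scrollGrading.gradedMonoid : SetLike.GradedMonoid (scrollGrading k n) where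
  one_mem := by
    rw [mem_scrollGrading_iff, map_one]
    exact SetLike.GradedOne.one_mem
  mul_mem i j a b ha hb := by
    rw [mem_scrollGrading_iff] at ha hb ⊢
    rw [map_mul]
    exact SetLike.GradedMul.mul_mem ha hb

theorem scrollGrading_isInternal : DirectSum.IsInternal (scrollGrading k n) := by
  have h := AddMonoidAlgebra.gradeBy.isInternal (R := k) (scrollDegree n)
  rw [DirectSum.isInternal_submodule_iff_iSupIndep_and_iSup_eq_top] at h ⊢
  let e := Submodule.orderIsoMapComap (scrollEquiv k n).toLinearEquiv
  have he : scrollGrading k n = e.symm ∘ AddMonoidAlgebra.gradeBy k (scrollDegree n) :=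
    funext fun j => Submodule.ext fun a => mem_scrollGrading_iff j a
  rw [he, iSupIndep_map_orderIso_iff]
  refine ⟨h.1, ?_⟩
  refine (e.symm.map_iSup _).symm.trans ?_
  rw [h.2, map_top]

instance scrollGrading.gradedAlgebra : GradedAlgebra (scrollGrading k n) where
  toDecomposition := scrollGrading_isInternal.chooseDecomposition

theorem scrollGrading_of_neg (j : ℤ) (hj : j < 0) : scrollGrading k n j = ⊥ := by
  obtain m | m := j
  · simp at hj
    omega
  · exact Submodule.map_bot _

theorem naturalCoordinates_subset : naturalCoordinates k n ⊆ scrollGrading k n 1 := by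
  rintro _ ⟨v, rfl⟩
  exact ⟨MvPolynomial.X v, MvPolynomial.isHomogeneous_X k v, rfl⟩

/-- Membership in an ideal generated by natural coordinates is decided by the monomials. -/
theorem mem_span_scrollCoordinate_iff (Z : Set (ScrollVar n)) (a : Scroll k n) :
    a ∈ Ideal.span (scrollCoordinate k '' Z) ↔
      ∀ x ∈ (scrollEquiv k n a).coeff.support, ∃ v ∈ Z, ∃ d, x = d + scrollPoint v := by
  have h : Ideal.map (scrollEquiv k n) (Ideal.span (scrollCoordinate k '' Z)) =
      Ideal.span (AddMonoidAlgebra.of' k (scrollMonoid n) '' (scrollPoint '' Z)) := by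
    rw [Ideal.map_span, Set.image_image, Set.image_image]
    simp only [scrollEquiv_scrollCoordinate, AddMonoidAlgebra.of'_apply]
  have h' : a ∈ Ideal.span (scrollCoordinate k '' Z) ↔
      scrollEquiv k n a ∈ Ideal.map (scrollEquiv k n) (Ideal.span (scrollCoordinate k '' Z)) := by
    rw [Ideal.mem_map_of_equiv]
    simp
  rw [h', h, AddMonoidAlgebra.mem_ideal_span_of'_image]
  simp only [Set.exists_mem_image]

theorem support_scrollEquiv_mul_scrollCoordinate (a : Scroll k n) (v : ScrollVar n) :
    (scrollEquiv k n (a * scrollCoordinate k v)).coeff.support =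
      (scrollEquiv k n a).coeff.support.map (addRightEmbedding (scrollPoint v)) := by
  rw [map_mul, scrollEquiv_scrollCoordinate,
    AddMonoidAlgebra.support_coeff_mul_single _ _ (by simp)]

theorem mul_scrollCoordinate_mem_span_iff (Z : Set (ScrollVar n)) (a : Scroll k n)
    (w : ScrollVar n) : a * scrollCoordinate k w ∈ Ideal.span (scrollCoordinate k '' Z) ↔
      ∀ x ∈ (scrollEquiv k n a).coeff.support, ∃ v ∈ Z, ∃ d,
        x + scrollPoint w = d + scrollPoint v := by
  rw [mem_span_scrollCoordinate_iff, support_scrollEquiv_mul_scrollCoordinate]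
  simp only [Finset.mem_map, forall_exists_index, and_imp, forall_apply_eq_imp_iff₂,
    addRightEmbedding_apply]

/-- If all blocks of the scroll have the same size, then a nontrivial multidegree in a colon monoid
ideal of two variables is divisible by a variable with the same property. -/
theorem exists_scrollPoint_of_colon (hn : ∀ i j, n i = n j) {v w : ScrollVar n} (hvw : v ≠ w)
    {x d : scrollMonoid n} (h : x + scrollPoint w = d + scrollPoint v) :
    ∃ (u : ScrollVar n) (x' d' : scrollMonoid n), x = x' + scrollPoint u ∧
      scrollPoint u + scrollPoint w = d' + scrollPoint v := by
  obtain ⟨i, p⟩ := v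
  obtain ⟨j, q⟩ := w
  obtain ⟨⟨α, a⟩, hx⟩ := x
  obtain ⟨⟨β, b⟩, hd⟩ := d
  have hsum : ∀ γ : Multiset (Fin t), (γ.map n).sum = γ.card * n i := by
    intro γ
    rw [Multiset.map_congr rfl fun l _ => hn l i]
    simp
  rw [mem_scrollMonoid, hsum] at hx hd
  simp only [scrollPoint, AddMemClass.mk_add_mk, Prod.mk_add_mk, Subtype.mk.injEq,
    Prod.mk.injEq] at h
  obtain ⟨hα, ha⟩ := h
  have hcard : α.card = β.card := by simpa using congrArg Multiset.card hα
  -- The block of `u` must make `u * w` contain block `i`. For `i ≠ j` this forces `l = i`; for `i =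
  -- j` any block of `α` works, and `α` is nonempty since `v ≠ w`.
  obtain ⟨l, α', γ, rfl, hγ⟩ : ∃ (l : Fin t) (α' γ : Multiset (Fin t)), α = l ::ₘ α' ∧
      ({l} : Multiset (Fin t)) + {j} = γ + {i} := by
    by_cases hij : i = j
    · subst hij
      obtain ⟨l, hl⟩ : ∃ l, l ∈ α := by
        refine Multiset.exists_mem_of_ne_zero ?_
        rintro rfl
        rw [← hcard] at hd
        simp only [Multiset.card_zero, zero_mul, Nat.le_zero] at hx hd
        refine hvw ?_
        congr 1
        exact Fin.ext (by omega)
      obtain ⟨α', rfl⟩ := Multiset.exists_cons_of_mem hl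
      exact ⟨l, α', {l}, rfl, rfl⟩
    · have hi : i ∈ α + {j} := by simp [hα]
      obtain ⟨α', rfl⟩ := Multiset.exists_cons_of_mem
        ((Multiset.mem_add.1 hi).resolve_right (by simpa using hij))
      exact ⟨i, α', {j}, rfl, add_comm _ _⟩
  have hγcard : γ.card = 1 := by
    have := congrArg Multiset.card hγ
    simp at this
    omega
  rw [← hcard, Multiset.card_cons, add_mul, one_mul] at hd
  rw [Multiset.card_cons, add_mul, one_mul] at hx
  have hp := p.2
  have hq := q.2
  have hji := hn j i
  have hli := hn l i
  simp only at hx hd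
  -- The least admissible position for `u`: it must satisfy `p ≤ c + q`, and the rest `a - c` must
  -- fit into the blocks of `α'`. The equal block sizes make this `c` at most `n l` and `c + q - p`
  -- at most the size of the block in `γ`.
  obtain ⟨c, hc⟩ : ∃ c : ℕ, c = max ((p : ℕ) - q) (a - α'.card * n i) := ⟨_, rfl⟩
  refine ⟨⟨l, ⟨c, by omega⟩⟩, ⟨(α', a - c), ?_⟩, ⟨(γ, c + q - p), ?_⟩, ?_, ?_⟩
  · rw [mem_scrollMonoid, hsum]
    simp only
    omega
  · rw [mem_scrollMonoid, hsum, hγcard]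
    simp only
    omega
  · refine Subtype.ext (Prod.ext ?_ ?_)
    · exact (Multiset.add_comm _ _).trans (Multiset.singleton_add l α') |>.symm
    · simp [scrollPoint]
      omega
  · refine Subtype.ext (Prod.ext hγ ?_)
    simp [scrollPoint]
    omega

theorem naturalCoordinates_hasLinearColonIdeals [Nontrivial k] (hn : ∀ i j, n i = n j) :
    HasLinearColonIdeals (naturalCoordinates k n) := by
  rintro Y hY _ ⟨w, rfl⟩ hw
  obtain ⟨Z, rfl⟩ : ∃ Z, Y = scrollCoordinate k '' Z :=
    (Set.subset_range_iff_exists_image_eq.1 hY).imp fun _ h => h.symm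
  let Z' : Set (ScrollVar n) :=
    {u | ∃ v ∈ Z, ∃ d, scrollPoint u + scrollPoint w = d + scrollPoint v}
  refine ⟨scrollCoordinate k '' Z', Set.image_subset_range _ _, fun a => ?_⟩
  change a * scrollCoordinate k w ∈ _ ↔ _
  rw [mul_scrollCoordinate_mem_span_iff, mem_span_scrollCoordinate_iff]
  refine forall₂_congr fun x _ => ?_
  constructor
  · rintro ⟨v, hv, d, h⟩
    have hvw : v ≠ w := by
      rintro rfl
      exact hw ⟨v, hv, rfl⟩
    obtain ⟨u, x', d', hx, hu⟩ := exists_scrollPoint_of_colon hn hvw h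
    exact ⟨u, ⟨v, hv, d', hu⟩, x', hx⟩
  · rintro ⟨u, ⟨v, hv, d', hu⟩, x', rfl⟩
    exact ⟨v, hv, x' + d', by rw [add_assoc, hu, add_assoc]⟩

theorem scrollMonoid_eq_zero {x : scrollMonoid n} (hx : scrollDegree n x = 0) : x = 0 := by
  obtain ⟨⟨α, a⟩, h⟩ := x
  have hα : α = 0 := by simpa [scrollDegree_apply] using hx
  subst hα
  have ha : a = 0 := by simpa [mem_scrollMonoid] using h
  subst ha
  rfl

theorem scrollDegree_scrollPoint (v : ScrollVar n) : scrollDegree n (scrollPoint v) = 1 := rfl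

/-- A constant term of `a` would make `w` a multiple of `v`, and equality of degrees would give `v =
w`. This yields the minimality of two distinct coordinates as generators. -/
theorem mem_positiveIdeal_of_mul_scrollCoordinate_mem {v w : ScrollVar n} (hvw : v ≠ w)
    {a : Scroll k n} (ha : a * scrollCoordinate k w ∈ Ideal.span {scrollCoordinate k v}) :
    a ∈ positiveIdeal (scrollGrading k n) := by
  rw [← Set.image_singleton, mul_scrollCoordinate_mem_span_iff] at ha
  rw [← (scrollEquiv k n).symm_apply_apply a, ← (scrollEquiv k n a).sum_coeff_single, Finsupp.sum,
    map_sum]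
  refine Ideal.sum_mem _ fun x hx => mem_positiveIdeal_of_mem (j := scrollDegree n x) ?_ ?_
  · refine lt_of_le_of_ne (by simp [scrollDegree_apply]) fun h0 => hvw ?_
    obtain ⟨_, rfl, d, hd⟩ := ha x hx
    have hd0 := congrArg (scrollDegree n) hd
    rw [map_add, map_add, ← h0, scrollDegree_scrollPoint, scrollDegree_scrollPoint] at hd0
    rw [scrollMonoid_eq_zero h0.symm, scrollMonoid_eq_zero (by omega : scrollDegree n d = 0),
      zero_add, zero_add] at hd
    exact (scrollPoint_injective hd).symm
  · rw [mem_scrollGrading_iff, AlgEquiv.apply_symm_apply]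
    exact AddMonoidAlgebra.single_mem_gradeBy _ _ _

/-- If the blocks `l` and `i` of the scroll satisfy `n l < n i`, then the quotient by the first and
the last variable of block `i` does not have a linear resolution. -/
theorem regularity_ne_zero_of_lt [Nontrivial k] (hn : ∀ i, 1 ≤ n i) {i l : Fin t}
    (hil : n l < n i) :
    ∃ Y ⊆ naturalCoordinates k n, castelnuovoMumfordRegularity (scrollGrading k n)
      (quotientGrading (scrollGrading k n) (Ideal.span Y)) ≠ 0 := by
  let v : ScrollVar n := ⟨i, Fin.last (n i)⟩
  let w : ScrollVar n := ⟨i, 0⟩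
  have hvw : v ≠ w := by
    intro h
    have h : Fin.last (n i) = 0 := by simpa [v, w] using h
    have := congrArg Fin.val h
    simp at this
    omega
  let y : Fin 2 → Scroll k n := ![scrollCoordinate k v, scrollCoordinate k w]
  have hy : ∀ x, Fintype.linearCombination (Scroll k n) y x =
      x 0 * scrollCoordinate k v + x 1 * scrollCoordinate k w := fun x => by
    simp [Fintype.linearCombination_apply, y]
  have hyV : Set.range y ⊆ naturalCoordinates k n := by
    rintro _ ⟨b, rfl⟩
    fin_cases b
    · exact ⟨v, rfl⟩
    · exact ⟨w, rfl⟩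
  have hcol : ∀ x, Fintype.linearCombination (Scroll k n) y x = 0 →
      x 1 * scrollCoordinate k w ∈ Ideal.span {scrollCoordinate k v} := fun x hx => by
    rw [hy, add_comm] at hx
    rw [Ideal.mem_span_singleton', eq_neg_of_add_eq_zero_left hx]
    exact ⟨-x 0, by ring⟩
  have hcol' : ∀ x, Fintype.linearCombination (Scroll k n) y x = 0 →
      x 0 * scrollCoordinate k v ∈ Ideal.span {scrollCoordinate k w} := fun x hx => by
    rw [hy] at hx
    rw [Ideal.mem_span_singleton', eq_neg_of_add_eq_zero_left hx]
    exact ⟨-x 1, by ring⟩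
  refine ⟨Set.range y, hyV, fun hreg => ?_⟩
  have : Nontrivial (Scroll k n) := (scrollEquiv k n).toEquiv.nontrivial
  have hle := ker_linearCombination_le_of_regularity_eq_zero scrollGrading_of_neg y
    (fun j => naturalCoordinates_subset (hyV ⟨j, rfl⟩)) (fun x hx b => by
      fin_cases b
      · exact mem_positiveIdeal_of_mul_scrollCoordinate_mem hvw.symm (hcol' x hx)
      · exact mem_positiveIdeal_of_mul_scrollCoordinate_mem hvw (hcol x hx)) hreg
  -- If the syzygies of `v, w` are generated in degree at most `1`, their second coordinates lie in
  -- the ideal generated by the monomials of `(v) : w` of degree at most `1`.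
  let s : Set (scrollMonoid n) := {x | scrollDegree n x ≤ 1 ∧
    ∃ d, x + scrollPoint w = d + scrollPoint v}
  let K : Ideal (Scroll k n) := Ideal.comap (scrollEquiv k n)
    (Ideal.span (AddMonoidAlgebra.of' k (scrollMonoid n) '' s))
  have hK : LinearMap.ker (Fintype.linearCombination (Scroll k n) y) ≤
      Submodule.comap (LinearMap.proj (φ := fun _ : Fin 2 => Scroll k n) 1) K := by
    refine hle.trans (Submodule.span_le.2 ?_)
    rintro x ⟨hx, j, hj, hxj⟩
    change scrollEquiv k n (x 1) ∈ Ideal.span _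
    rw [AddMonoidAlgebra.mem_ideal_span_of'_image]
    intro m hm
    have hdeg := (mem_scrollGrading_iff _ _).1 (hxj 1) m hm
    have h1 := hcol x hx
    rw [← Set.image_singleton, mul_scrollCoordinate_mem_span_iff] at h1
    obtain ⟨_, rfl, d, hd⟩ := h1 m hm
    exact ⟨m, ⟨hdeg.trans_le hj, d, hd⟩, 0, (zero_add m).symm⟩
  let u : ScrollVar n := ⟨l, Fin.last (n l)⟩
  let g : Scroll k n := scrollCoordinate k u ^ n i
  have hg : scrollEquiv k n g = AddMonoidAlgebra.single (n i • scrollPoint u) 1 := by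
    rw [map_pow, scrollEquiv_scrollCoordinate, AddMonoidAlgebra.single_pow, one_pow]
  have hsupp : (scrollEquiv k n g).coeff.support = {n i • scrollPoint u} := by
    rw [hg, AddMonoidAlgebra.coeff_single, Finsupp.support_single _ one_ne_zero]
  have hle' : n i ≤ n i * n l := Nat.le_mul_of_pos_right _ (hn l)
  have hgw : g * scrollCoordinate k w ∈ Ideal.span {scrollCoordinate k v} := by
    rw [← Set.image_singleton, mul_scrollCoordinate_mem_span_iff, hsupp]
    intro x hx
    rw [Finset.mem_singleton] at hx
    subst hx
    -- The power `g` has total position `n i * n l`, so `n i` units can be moved to `w`, turning it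
    -- into `v`. By `hle'` the subtraction is not truncated.
    refine ⟨v, rfl, ⟨(n i • {l}, n i * n l - n i), ?_⟩, Subtype.ext (Prod.ext ?_ ?_)⟩
    · rw [mem_scrollMonoid, Multiset.map_nsmul, Multiset.sum_nsmul]
      simp
    · simp [scrollPoint, u, v, w]
    · simp [scrollPoint, u, v, w, hle']
  obtain ⟨c, hc⟩ := Ideal.mem_span_singleton'.1 hgw
  have hgK : scrollEquiv k n g ∈ Ideal.span (AddMonoidAlgebra.of' k (scrollMonoid n) '' s) := by
    have h : (![-c, g] : Fin 2 → Scroll k n) ∈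
        LinearMap.ker (Fintype.linearCombination (Scroll k n) y) := by
      rw [LinearMap.mem_ker, hy]
      simp [hc]
    exact hK h
  rw [AddMonoidAlgebra.mem_ideal_span_of'_image, hsupp] at hgK
  obtain ⟨⟨⟨α, a⟩, hx⟩, ⟨hdeg, ⟨⟨β, b⟩, hβ⟩, hd⟩, ⟨⟨α', a'⟩, hx'⟩, heq⟩ :=
    hgK _ (Finset.mem_singleton_self _)
  have ha : a = b + n i := by simpa [scrollPoint, v, w] using congrArg (fun z => z.1.2) hd
  have hα : n i • {l} = α' + α := congrArg (fun z => z.1.1) heq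
  have hcard : α.card ≤ 1 := by
    rw [scrollDegree_apply] at hdeg
    exact_mod_cast hdeg
  replace hx : a ≤ (α.map n).sum := hx
  -- Membership in the colon ideal needs `a ≥ n i`. A divisor of `g` of degree at most `1` has `α =
  -- 0` or `α = {l}`, so `a ≤ n l < n i`.
  rcases Nat.le_one_iff_eq_zero_or_eq_one.1 hcard with h | h
  · rw [Multiset.card_eq_zero] at h
    subst h
    simp at hx
    omega
  · obtain ⟨l', rfl⟩ := Multiset.card_eq_one.1 h
    have hl' : l' ∈ n i • ({l} : Multiset (Fin t)) := by rw [hα]; simp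
    rw [Multiset.mem_singleton.1 (Multiset.mem_of_mem_nsmul hl')] at hx
    simp at hx
    omega

end ScrollGrading

end

theorem proposition6 {k : Type*} [Field k] {t : ℕ} (ht : 1 ≤ t) (n : Fin t → ℕ)
    (hn : ∀ i, 1 ≤ n i) :
    (∀ Y ⊆ naturalCoordinates k n,
      castelnuovoMumfordRegularity (scrollGrading k n)
        (quotientGrading (scrollGrading k n) (Ideal.span Y)) = 0) ↔
      ∀ i j, n i = n j := by
  constructor
  · intro h i j
    by_contra hij
    rcases lt_or_gt_of_ne hij with hlt | hlt
    · obtain ⟨Y, hY, hreg⟩ := regularity_ne_zero_of_lt (k := k) hn hlt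
      exact hreg (h Y hY)
    · obtain ⟨Y, hY, hreg⟩ := regularity_ne_zero_of_lt (k := k) hn hlt
      exact hreg (h Y hY)
  · intro h Y hY
    have : Nontrivial (Scroll k n) := (scrollEquiv k n).toEquiv.nontrivial
    exact castelnuovoMumfordRegularity_quotient_eq_zero scrollGrading_of_neg (Set.finite_range _)
      naturalCoordinates_subset (naturalCoordinates_hasLinearColonIdeals h) hY
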